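/- **Definitions.** Fix numbers $k$ of settings, $m$ of outcomes and a dimension $D$, and write $H_D=\mathbb C^D$. A steering functional is a family $F=\{F_x^a: 1\le x\le k,\ 1\le a\le m\}$ of $D\times D$ complex matrices; its value on a family $\sigma=\{\sigma_x^a\}$ of $D\times D$ matrices is $\langle F,\sigma\rangle=\sum_{x,a}\operatorname{Tr}(F_x^a\sigma_x^a)$. Let $\mathcal Q^{\rm in}$ be the set of families $\sigma_x^a=\operatorname{Tr}_A((E_x^a\otimes 1)\rho)$, where $\rho$ is a density matrix on $H\otimes H_D$ for some finite-dimensional Hilbert space $H$, and $E_x^a\ge 0$ are operators on $H$ with $\sum_a E_x^a\le 1$ for every $x$. Let $\mathcal L^{\rm in}$ be the set of families $\sigma_x^a=\sum_\lambda q_\lambda\,p_\lambda(a|x)\,\sigma_\lambda$ (finite sums), where $q_\lambda\ge0$, $\sum_\lambda q_\lambda=1$, each $\sigma_\lambda$ is a density matrix on $H_D$, $p_\lambda(a|x)\ge 0$ and $\sum_a p_\lambda(a|x)\le 1$. Put $$B_C(F)=\sup_{\sigma\in\mathcal L^{\rm in}}|\langle F,\sigma\rangle|,\qquad B_Q(F)=\sup_{\sigma\in\mathcal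 Q^{\rm in}}|\langle F,\sigma\rangle|,\qquad LV(F)=\frac{B_Q(F)}{B_C(F)}.$$ For $1\le d\le D$ let $|\psi_d\rangle=\frac1{\sqrt d}\sum_{i=1}^d|ii\rangle\in H_d\otimes H_D$, where $H_d$ is also regarded as the span of the first $d$ basis vectors of $H_D$, and let $\mathcal Q_{|\psi_d\rangle}$ be the set of assemblages $\sigma_x^a=\operatorname{Tr}_A((E_x^a\otimes 1)|\psi_d\rangle\langle\psi_d|)$, where $\{E_x^a\}_a$ is a POVM on $H_d$ for every $x$. **Theorem.** There are universal constants $c,C>0$ such that for every integer $n\ge2$ there is a steering functional $\widetilde F=\{\widetilde F_x^a\in B(H_{n+1}): x=1,\dots,2^{n^2},\ a=1,\dots,n+1\}$, consisting of Hermitian matrices, such that 1. $LV(\widetilde F)\ \ge\ c\,\dfrac{\sqrt n}{\sqrt{\log n}}$; more precisely, $0<B_C(\widetilde F)\le C\sqrt{\log n}$ and $B_Q(\widetilde F)\ge c\sqrt n$; 2. for every $1\le d\le n+1$ (in particular for $d=n$ and for $d=n+1$) and every $\Theta\in\mathcal Q_{|\psi_d\rangle}$, $|\langle\widetilde F,\Theta\rangle|\le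 C\sqrt{\log n}$. -/

import Mathlib

open scoped Kronecker ComplexOrder

namespace Steering

/-- `ρ` is a density matrix: positive semidefinite with trace one. -/
def IsDensityMatrix {ι : Type*} [Fintype ι] (ρ : Matrix ι ι ℂ) : Prop :=
  ρ.PosSemidef ∧ ρ.trace = 1

/-- `E` is a POVM with `m` outcomes: positive operators summing to the identity. -/
def IsPOVM {ι : Type*} [Fintype ι] [DecidableEq ι] {m : ℕ} (E : Fin m → Matrix ι ι ℂ) : Prop :=
  (∀ a, (E a).PosSemidef) ∧ ∑ a, E a = 1

/-- `E` is an incomplete POVM: positive operators whose sum is at most the identity. -/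
def IsIncompletePOVM {ι : Type*} [Fintype ι] [DecidableEq ι] {m : ℕ}
    (E : Fin m → Matrix ι ι ℂ) : Prop :=
  (∀ a, (E a).PosSemidef) ∧ (1 - ∑ a, E a).PosSemidef

/-- The partial trace over the first (Alice's) tensor factor. -/
def partialTraceA {ι κ : Type*} [Fintype ι] (M : Matrix (ι × κ) (ι × κ) ℂ) : Matrix κ κ ℂ :=
  Matrix.of fun j j' => ∑ i, M (i, j) (i, j')

/-- A family of `d × d` matrices indexed by `k` settings and `m` outcomes. Both steering
functionals and (incomplete) assemblages are such families. -/
abbrev Family (k m d : ℕ) : Type := Fin k → Fin m → Matrix (Fin d) (Fin d) ℂ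

/-- The family `σ_x^a = Tr_A ((E_x^a ⊗ 1) ρ)` that Alice's operators `E_x^a` on `ℂ^N`
and the state `ρ` on `ℂ^N ⊗ ℂ^d` produce on Bob's side. -/
def steered {k m N d : ℕ} (E : Fin k → Fin m → Matrix (Fin N) (Fin N) ℂ)
    (ρ : Matrix (Fin N × Fin d) (Fin N × Fin d) ℂ) : Family k m d :=
  fun x a => partialTraceA ((E x a ⊗ₖ (1 : Matrix (Fin d) (Fin d) ℂ)) * ρ)

/-- The set `𝒬^in` of incomplete quantum assemblages. -/
def quantumIncomplete (k m d : ℕ) : Set (Family k m d) :=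
  {σ | ∃ (N : ℕ) (ρ : Matrix (Fin N × Fin d) (Fin N × Fin d) ℂ)
      (E : Fin k → Fin m → Matrix (Fin N) (Fin N) ℂ),
      IsDensityMatrix ρ ∧ (∀ x, IsIncompletePOVM (E x)) ∧ σ = steered E ρ}

/-- The set `ℒ^in` of incomplete assemblages that admit a local hidden state model. -/
def lhsIncomplete (k m d : ℕ) : Set (Family k m d) :=
  {σ | ∃ (L : ℕ) (q : Fin L → ℝ) (τ : Fin L → Matrix (Fin d) (Fin d) ℂ)
      (p : Fin L → Fin k → Fin m → ℝ),
      (∀ l, 0 ≤ q l) ∧ ∑ l, q l = 1 ∧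
      (∀ l, IsDensityMatrix (τ l)) ∧
      (∀ l x a, 0 ≤ p l x a) ∧ (∀ l x, ∑ a, p l x a ≤ 1) ∧
      ∀ x a, σ x a = ∑ l, ((q l * p l x a : ℝ) : ℂ) • τ l}

/-- The value `⟨F, σ⟩ = ∑_{x,a} Tr (F_x^a σ_x^a)`. -/
def pairing {k m d : ℕ} (F σ : Family k m d) : ℂ :=
  ∑ x, ∑ a, (F x a * σ x a).trace

/-- The LHS bound `B_C(F)`. -/
noncomputable def lhsBound {k m d : ℕ} (F : Family k m d) : ℝ :=
  sSup ((fun σ => ‖pairing F σ‖) '' lhsIncomplete k m d)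

/-- The quantum bound `B_Q(F)`. -/
noncomputable def quantumBound {k m d : ℕ} (F : Family k m d) : ℝ :=
  sSup ((fun σ => ‖pairing F σ‖) '' quantumIncomplete k m d)

/-- The largest violation `LV(F) = B_Q(F) / B_C(F)`. -/
noncomputable def largestViolation {k m d : ℕ} (F : Family k m d) : ℝ :=
  quantumBound F / lhsBound F

/-- The vector `|ψ_d⟩ = d^{-1/2} ∑_{i < d} |i⟩ ⊗ |i⟩` in `ℂ^d ⊗ ℂ^D`, where `d ≤ D` and
`ℂ^d` is identified with the span of the first `d` basis vectors of `ℂ^D`. -/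
noncomputable def maxEntangledVector (d D : ℕ) : Fin d × Fin D → ℂ :=
  fun ij => if (ij.1 : ℕ) = (ij.2 : ℕ) then ((1 / √(d : ℝ) : ℝ) : ℂ) else 0

/-- The projection `|ψ_d⟩⟨ψ_d|`. -/
noncomputable def maxEntangledState (d D : ℕ) : Matrix (Fin d × Fin D) (Fin d × Fin D) ℂ :=
  Matrix.vecMulVec (maxEntangledVector d D) (star (maxEntangledVector d D))

/-- The set `𝒬_{|ψ_d⟩}` of the assemblages on `ℂ^D` that Alice's POVMs produce from the
`d`-dimensional maximally entangled state. -/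
def maxEntangledAssemblages (k m d D : ℕ) : Set (Family k m D) :=
  {σ | ∃ E : Fin k → Fin m → Matrix (Fin d) (Fin d) ℂ,
      (∀ x, IsPOVM (E x)) ∧ σ = steered E (maxEntangledState d D)}

end Steering

/-! The functional couples the basis vector 0 to the vectors `v_x^a` with coordinates `ε_x(k)
ω^{a(k+1)}`, `0 ≤ k < n`, where `ε_x` runs through sign patterns and `ω` is a primitive root of
unity of order `n + 1`.

A hidden state `τ` enters only through its entries `τ_{0k}`, whose ℓ² norm is at most 1. The local
value is therefore controlled by the mean over `x` of the largest of `n + 1` Rademacher sums with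
coefficients in the unit ball, which is `O(√log n)` (`sum_settings_weight_mul_norm_le`).

For each `x` the vectors `(1, v_x^a)/√(n+1)` form an orthonormal basis, by orthogonality of
characters, so they define a measurement. On a state with Schmidt coefficients `t_i`, entry `(0, k)`
of the functional is weighted by `t_0 t_k`. Putting half of the mass on `|00⟩` makes this product
`1/(2√n)`, and the `n` coordinates add up to `√n` (`sqrt_le_quantumBound_phaseFunctional`).

For a maximally entangled state the product is only `1/d`, and `∑_a |E^a_{0k}| ≤ 1` for every POVM,
so the value stays below the constant 2 whatever the signs are
(`norm_pairing_phaseFunctional_le_of_maxEntangled`). -/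

namespace Steering

/-! ### Entries of positive semidefinite matrices -/

section PosSemidef

variable {ι : Type*} {M : Matrix ι ι ℂ}

/-- The principal 2 × 2 minor on `i, j` is nonnegative. -/
lemma PosSemidef.norm_apply_sq_le (hM : M.PosSemidef) (i j : ι) :
    ‖M i j‖ ^ 2 ≤ (M i i).re * (M j j).re := by
  have h := (hM.submatrix ![i, j]).det_nonneg
  rw [Matrix.det_fin_two] at h
  simp only [Matrix.submatrix_apply, Matrix.cons_val_zero, Matrix.cons_val_one] at h
  have hi := Complex.nonneg_iff.1 (hM.diag_nonneg (i := i))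
  have hj := Complex.nonneg_iff.1 (hM.diag_nonneg (i := j))
  have hre := (Complex.nonneg_iff.1 h).1
  rw [← hM.isHermitian.apply j i, Complex.star_def, Complex.mul_conj'] at hre
  simp only [Complex.sub_re, Complex.mul_re, ← hi.2, ← hj.2] at hre
  norm_cast at hre
  nlinarith

lemma PosSemidef.re_diag_nonneg (hM : M.PosSemidef) (i : ι) : 0 ≤ (M i i).re :=
  (Complex.nonneg_iff.1 hM.diag_nonneg).1

lemma PosSemidef.norm_apply_le (hM : M.PosSemidef) (i j : ι) :
    ‖M i j‖ ≤ ((M i i).re + (M j j).re) / 2 := by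
  have h := norm_apply_sq_le hM i j
  have hi := re_diag_nonneg hM i
  have hj := re_diag_nonneg hM j
  refine abs_le_of_sq_le_sq' ?_ (by positivity) |>.2
  nlinarith [sq_nonneg ((M i i).re - (M j j).re)]

lemma PosSemidef.re_diag_le_re_trace [Fintype ι] (hM : M.PosSemidef) (i : ι) :
    (M i i).re ≤ M.trace.re := by
  rw [Matrix.trace, Complex.re_sum]
  exact Finset.single_le_sum (f := fun i => (M i i).re) (fun j _ => re_diag_nonneg hM j)
    (Finset.mem_univ i)

lemma PosSemidef.norm_apply_le_re_trace [Fintype ι] (hM : M.PosSemidef) (i j : ι) :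
    ‖M i j‖ ≤ M.trace.re := by
  have := norm_apply_le hM i j
  have := re_diag_le_re_trace hM i
  have := re_diag_le_re_trace hM j
  linarith

end PosSemidef

/-! ### Partial traces and steered families -/

section PartialTrace

variable {ι κ : Type*} [Fintype ι] [Fintype κ]

lemma trace_partialTraceA (ρ : Matrix (ι × κ) (ι × κ) ℂ) :
    (partialTraceA ρ).trace = ρ.trace := by
  simp [partialTraceA, Matrix.trace, Fintype.sum_prod_type_right]

variable [DecidableEq κ]

lemma partialTraceA_kronecker_one_mul_apply (E : Matrix ι ι ℂ) (ρ : Matrix (ι × κ) (ι × κ) ℂ)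
    (j j' : κ) :
    partialTraceA ((E ⊗ₖ (1 : Matrix κ κ ℂ)) * ρ) j j' =
      ∑ i, ∑ i', E i i' * ρ (i', j) (i, j') := by
  simp [partialTraceA, Matrix.mul_apply, Fintype.sum_prod_type, Matrix.one_apply]

lemma posSemidef_partialTraceA_kronecker_one_mul {E : Matrix ι ι ℂ} (hE : E.PosSemidef)
    {ρ : Matrix (ι × κ) (ι × κ) ℂ} (hρ : ρ.PosSemidef) :
    (partialTraceA ((E ⊗ₖ (1 : Matrix κ κ ℂ)) * ρ)).PosSemidef := by
  obtain ⟨m, u, rfl⟩ := Matrix.posSemidef_iff_eq_sum_vecMulVec.1 hE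
  -- For `E = |u⟩⟨u|` the partial trace is the compression `W ρ W*` with `W = ⟨u| ⊗ 1`, which is
  -- visibly positive.
  let W : Fin m → Matrix κ (ι × κ) ℂ := fun l =>
    Matrix.of fun j p => if j = p.2 then star (u l p.1) else 0
  have : partialTraceA (((∑ l, Matrix.vecMulVec (u l) (star (u l))) ⊗ₖ (1 : Matrix κ κ ℂ)) * ρ)
      = ∑ l, W l * ρ * (W l).conjTranspose := by
    ext j j'
    rw [partialTraceA_kronecker_one_mul_apply, Matrix.sum_apply]
    simp only [Matrix.sum_apply, Finset.sum_mul]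
    rw [Finset.sum_congr rfl fun i _ => Finset.sum_comm, Finset.sum_comm]
    refine Finset.sum_congr rfl fun l _ => ?_
    simp only [Matrix.mul_apply, Fintype.sum_prod_type, W, Matrix.of_apply,
      Matrix.conjTranspose_apply, Matrix.vecMulVec_apply, Pi.star_apply, Finset.sum_mul]
    refine Finset.sum_congr rfl fun i _ => ?_
    simp [apply_ite]
    refine Finset.sum_congr rfl fun i' _ => ?_
    ring
  rw [this]
  exact Matrix.posSemidef_sum _ fun l _ => hρ.mul_mul_conjTranspose_same (W l)

lemma re_trace_partialTraceA_le_one {m : ℕ} [DecidableEq ι] {E : Fin m → Matrix ι ι ℂ}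
    (hE : IsIncompletePOVM E) {ρ : Matrix (ι × κ) (ι × κ) ℂ} (hρ : IsDensityMatrix ρ)
    (a : Fin m) : (partialTraceA ((E a ⊗ₖ (1 : Matrix κ κ ℂ)) * ρ)).trace.re ≤ 1 := by
  have hnn : ∀ G : Matrix ι ι ℂ, G.PosSemidef →
      0 ≤ ((G ⊗ₖ (1 : Matrix κ κ ℂ)) * ρ).trace.re := fun G hG => by
    rw [← trace_partialTraceA]
    exact (Complex.nonneg_iff.1
      (posSemidef_partialTraceA_kronecker_one_mul hG hρ.1).trace_nonneg).1
  have h1 : (1 - E a).PosSemidef := by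
    have : 1 - E a = (1 - ∑ b, E b) + ∑ b ∈ Finset.univ.erase a, E b := by
      rw [← Finset.add_sum_erase _ _ (Finset.mem_univ a)]; abel
    rw [this]
    exact hE.2.add (Matrix.posSemidef_sum _ fun b _ => hE.1 b)
  have h := hnn _ h1
  have hsub : (1 - E a) ⊗ₖ (1 : Matrix κ κ ℂ) = 1 - E a ⊗ₖ 1 := by
    ext ⟨i, j⟩ ⟨i', j'⟩
    by_cases h : j = j' <;> simp [Matrix.one_apply, h]
  rw [hsub, Matrix.sub_mul, one_mul,
    Matrix.trace_sub, hρ.2] at h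
  rw [trace_partialTraceA]
  simpa using h

end PartialTrace

/-! ### Bounds on the pairing, and states in Schmidt form -/

variable {k m d : ℕ}

lemma norm_pairing_le (F σ : Family k m d) :
    ‖pairing F σ‖ ≤ ∑ x, ∑ a, ‖(F x a * σ x a).trace‖ :=
  (norm_sum_le _ _).trans (Finset.sum_le_sum fun _ _ => norm_sum_le _ _)

/-- A real `sSup` of an unbounded set is 0, so lower bounds on `quantumBound` need this. Steered
matrices are positive with trace at most 1, hence have entries of modulus at most 1. -/
lemma bddAbove_norm_pairing_quantumIncomplete (F : Family k m d) :
    BddAbove ((fun σ => ‖pairing F σ‖) '' quantumIncomplete k m d) := by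
  refine ⟨∑ x, ∑ a, ∑ i, ∑ j, ‖F x a i j‖, ?_⟩
  rintro _ ⟨σ, ⟨N, ρ, E, hρ, hE, rfl⟩, rfl⟩
  refine (norm_pairing_le F _).trans (Finset.sum_le_sum fun x _ => Finset.sum_le_sum fun a _ => ?_)
  simp only [Matrix.trace, Matrix.diag, Matrix.mul_apply]
  refine (norm_sum_le _ _).trans (Finset.sum_le_sum fun i _ => (norm_sum_le _ _).trans
    (Finset.sum_le_sum fun j _ => ?_))
  rw [norm_mul]
  refine mul_le_of_le_one_right (norm_nonneg _) ?_
  exact (PosSemidef.norm_apply_le_re_trace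
    (posSemidef_partialTraceA_kronecker_one_mul ((hE x).1 a) hρ.1) j i).trans
    (re_trace_partialTraceA_le_one (hE x) hρ a)

/-- The vector `∑_{i < N} t_i |i⟩ ⊗ |i⟩` in `ℂ^N ⊗ ℂ^D`. -/
noncomputable def diagVector {N : ℕ} (t : Fin N → ℝ) (D : ℕ) : Fin N × Fin D → ℂ :=
  fun ij => if (ij.1 : ℕ) = (ij.2 : ℕ) then (t ij.1 : ℂ) else 0

lemma sum_diagVector_mul {N D : ℕ} (h : N ≤ D) (t : Fin N → ℝ) (i : Fin N) (f : Fin D → ℂ) :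
    ∑ j, diagVector t D (i, j) * f j = t i * f (Fin.castLE h i) := by
  rw [Finset.sum_eq_single (Fin.castLE h i)]
  · simp [diagVector]
  · intro j _ hj
    have : (i : ℕ) ≠ j := fun hij => hj (Fin.ext (by simp [hij]))
    simp [diagVector, this]
  · simp

/-- Both entangled states of the proof have this form. `E` and `F` are paired entry by entry,
without a transpose. -/
lemma trace_mul_steered_diagVector {N D : ℕ} (h : N ≤ D) (t : Fin N → ℝ)
    (E : Fin k → Fin m → Matrix (Fin N) (Fin N) ℂ) (F : Matrix (Fin D) (Fin D) ℂ)
    (x : Fin k) (a : Fin m) :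
    (F * steered E (Matrix.vecMulVec (diagVector t D) (star (diagVector t D))) x a).trace =
      ∑ i, ∑ i', t i * t i' * E x a i i' * F (Fin.castLE h i) (Fin.castLE h i') := by
  have hst : ∀ p, star (diagVector t D p) = diagVector t D p := fun p => by
    unfold diagVector; split_ifs <;> simp
  calc _ = ∑ j, ∑ j', ∑ i, ∑ i', diagVector t D (i, j) * (diagVector t D (i', j') *
        (E x a i i' * F j j')) := by
        simp only [Matrix.trace, Matrix.diag, Matrix.mul_apply (M := F), steered,
          partialTraceA_kronecker_one_mul_apply, Matrix.vecMulVec_apply, Pi.star_apply, hst,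
          Finset.mul_sum]
        refine Finset.sum_congr rfl fun j _ => Finset.sum_congr rfl fun j' _ =>
          Finset.sum_congr rfl fun i _ => Finset.sum_congr rfl fun i' _ => ?_
        ring
    _ = ∑ i, ∑ i', ∑ j, diagVector t D (i, j) * ∑ j', diagVector t D (i', j') *
        (E x a i i' * F j j') := by
        simp only [Finset.mul_sum]
        rw [Finset.sum_congr rfl fun j _ => Finset.sum_comm, Finset.sum_comm]
        refine Finset.sum_congr rfl fun i _ => ?_
        rw [Finset.sum_congr rfl fun j _ => Finset.sum_comm, Finset.sum_comm]
    _ = _ := by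
        simp only [sum_diagVector_mul h]
        refine Finset.sum_congr rfl fun i _ => Finset.sum_congr rfl fun i' _ => ?_
        ring

/-! ### Maxima of Rademacher sums -/

section Signs

/-- The sign `±1` encoded by a Boolean. -/
def boolSign (b : Bool) : ℝ := if b then 1 else -1

lemma boolSign_sq (b : Bool) : boolSign b * boolSign b = 1 := by
  cases b <;> simp [boolSign]

/-- Independence factors the sum into hyperbolic cosines, and `cosh u ≤ exp (u²/2)`. -/
lemma sum_exp_sum_boolSign_le {ι : Type*} [Fintype ι] [DecidableEq ι] (c : ι → ℝ) :
    ∑ b : ι → Bool, Real.exp (∑ i, boolSign (b i) * c i) ≤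
      2 ^ Fintype.card ι * Real.exp ((∑ i, c i ^ 2) / 2) := by
  simp only [Real.exp_sum]
  rw [← Fintype.prod_sum (fun i b => Real.exp (boolSign b * c i)), Finset.sum_div, Real.exp_sum,
    ← Finset.card_univ, ← Finset.prod_const, ← Finset.prod_mul_distrib]
  refine Finset.prod_le_prod (fun i _ => by positivity) fun i _ => ?_
  have := Real.cosh_le_exp_half_sq (c i)
  rw [Real.cosh_eq] at this
  simp only [boolSign, Fintype.sum_bool, if_true, Bool.false_eq_true, if_false, one_mul, neg_mul]
  linarith

/-- The sign that the setting `x` attaches to the coordinate `k`. -/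
noncomputable def settingSign {n : ℕ} (x : Fin (2 ^ (n ^ 2))) (k : Fin n) : ℝ :=
  boolSign (Fintype.equivOfCardEq (β := Fin n × Fin n → Bool) (by simp [sq]) x (k, k))

lemma settingSign_sq {n : ℕ} (x : Fin (2 ^ (n ^ 2))) (k : Fin n) :
    settingSign x k * settingSign x k = 1 := boolSign_sq _

/-- Settings encode `n × n` arrays of signs of which only the diagonal is read; coefficients
supported on the diagonal reduce this to the previous estimate. -/
lemma sum_exp_sum_settingSign_le {n : ℕ} (c : Fin n → ℝ) :
    ∑ x, Real.exp (∑ k, settingSign x k * c k) ≤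
      2 ^ (n ^ 2) * Real.exp ((∑ k, c k ^ 2) / 2) := by
  have h := sum_exp_sum_boolSign_le fun p : Fin n × Fin n => if p.1 = p.2 then c p.1 else 0
  simp only [Fintype.sum_prod_type, mul_ite, mul_zero, Finset.sum_ite_eq, Finset.mem_univ,
    if_true, ite_pow, ne_eq, OfNat.ofNat_ne_zero, not_false_eq_true, zero_pow] at h
  have hcard : Fintype.card (Fin n × Fin n) = n ^ 2 := by simp [sq]
  rw [hcard] at h
  refine le_trans (le_of_eq ?_) h
  exact (Fintype.equivOfCardEq (β := Fin n × Fin n → Bool) (by simp [sq])).sum_comp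
    fun b => Real.exp (∑ k, boolSign (b (k, k)) * c k)

/-- Linear in `exp u` for fixed `M`, so it can be averaged over the settings without Jensen's
inequality. -/
lemma le_log_add_exp_div {M : ℝ} (hM : 0 < M) (u : ℝ) :
    u ≤ Real.log M + Real.exp u / M := by
  have := Real.add_one_le_exp (u - Real.log M)
  rw [Real.exp_sub, Real.exp_log hM] at this
  linarith

lemma exp_abs_le (u : ℝ) : Real.exp |u| ≤ Real.exp u + Real.exp (-u) := by
  rcases abs_cases u with ⟨h, _⟩ | ⟨h, _⟩ <;> rw [h] <;> linarith [Real.exp_pos u, Real.exp_pos (-u)]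

/-- A subnormalised average is at most any nonnegative bound on the maximum, and the maximum is
bounded by a sum of exponentials. `1 ≤ M` makes the bound nonnegative. -/
lemma sum_weight_mul_abs_le {m : ℕ} (p y : Fin m → ℝ) (hp : ∀ a, 0 ≤ p a) (hp1 : ∑ a, p a ≤ 1)
    {M s : ℝ} (hM : 1 ≤ M) (hs : 0 < s) :
    s * ∑ a, p a * |y a| ≤
      Real.log M + (∑ a, (Real.exp (s * y a) + Real.exp (-(s * y a)))) / M := by
  set B := Real.log M + (∑ a, (Real.exp (s * y a) + Real.exp (-(s * y a)))) / M
  have hM0 : 0 < M := by linarith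
  have hB : ∀ a, s * |y a| ≤ B := fun a => by
    refine (le_log_add_exp_div hM0 _).trans ?_
    refine add_le_add le_rfl (div_le_div_of_nonneg_right ?_ hM0.le)
    rw [← abs_of_pos hs, ← abs_mul, abs_of_pos hs]
    exact (exp_abs_le _).trans (Finset.single_le_sum
      (f := fun a => Real.exp (s * y a) + Real.exp (-(s * y a)))
      (fun _ _ => by positivity) (Finset.mem_univ a))
  have hB0 : 0 ≤ B := add_nonneg (Real.log_nonneg hM)
    (div_nonneg (Finset.sum_nonneg fun _ _ => by positivity) hM0.le)
  calc s * ∑ a, p a * |y a| = ∑ a, p a * (s * |y a|) := by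
        rw [Finset.mul_sum]; exact Finset.sum_congr rfl fun a _ => by ring
    _ ≤ ∑ a, p a * B := Finset.sum_le_sum fun a _ => mul_le_mul_of_nonneg_left (hB a) (hp a)
    _ = (∑ a, p a) * B := by rw [Finset.sum_mul]
    _ ≤ B := mul_le_of_le_one_left hB0 hp1

lemma sum_settings_weight_mul_abs_le {n : ℕ} (hn : 2 ≤ n)
    (p : Fin (2 ^ (n ^ 2)) → Fin (n + 1) → ℝ) (hp : ∀ x a, 0 ≤ p x a)
    (hp1 : ∀ x, ∑ a, p x a ≤ 1) (c : Fin (n + 1) → Fin n → ℝ) (hc : ∀ a, ∑ k, c a k ^ 2 ≤ 1) :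
    ∑ x, ∑ a, p x a * |∑ k, settingSign x k * c a k| ≤
      2 ^ (n ^ 2) * (6 * √(Real.log n)) := by
  have hn' : (2 : ℝ) ≤ n := by exact_mod_cast hn
  have hn0 : (0 : ℝ) < n := by linarith
  have hL : 0.69 ≤ Real.log n :=
    (by linarith [Real.log_two_gt_d9] : (0.69 : ℝ) ≤ Real.log 2).trans
      (Real.log_le_log (by norm_num) hn')
  -- This scale balances the terms `log M / s` and `s`: each exponential then averages to at most
  -- `n`.
  set s := √(Real.log n)
  have hs2 : s ^ 2 = Real.log n := Real.sq_sqrt (by linarith)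
  have hs : 0 < s := Real.sqrt_pos.2 (by linarith)
  set K : ℝ := 2 ^ (n ^ 2)
  have hK : 0 < K := by positivity
  have hexp : ∀ a, ∀ σ : ℝ, σ ^ 2 = s ^ 2 →
      ∑ x, Real.exp (σ * ∑ k, settingSign x k * c a k) ≤ K * n := fun a σ hσ => by
    have h := sum_exp_sum_settingSign_le fun k => σ * c a k
    simp only [mul_pow, ← Finset.mul_sum, mul_left_comm _ σ] at h
    refine h.trans (mul_le_mul_of_nonneg_left ?_ hK.le)
    rw [← Real.le_log_iff_exp_le hn0, hσ, hs2]
    have := hc a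
    nlinarith
  have hmain : s * ∑ x, ∑ a, p x a * |∑ k, settingSign x k * c a k| ≤ K * (6 * s ^ 2) := by
    rw [Finset.mul_sum]
    -- With `M = n³`, the `2(n+1)` exponentials of mean at most `n` contribute only `2(n+1)/n² ≤
    -- 3/2`.
    calc _ ≤ ∑ x : Fin (2 ^ (n ^ 2)), (Real.log ((n : ℝ) ^ 3) +
            (∑ a, (Real.exp (s * ∑ k, settingSign x k * c a k) +
              Real.exp (-(s * ∑ k, settingSign x k * c a k)))) / (n : ℝ) ^ 3) :=
          Finset.sum_le_sum fun x _ => sum_weight_mul_abs_le (p x) _ (hp x) (hp1 x)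
            (one_le_pow₀ (by linarith)) hs
      _ = K * Real.log ((n : ℝ) ^ 3) +
            (∑ a, (∑ x, Real.exp (s * ∑ k, settingSign x k * c a k) +
              ∑ x, Real.exp (-s * ∑ k, settingSign x k * c a k))) / (n : ℝ) ^ 3 := by
          rw [Finset.sum_add_distrib, ← Finset.sum_div, Finset.sum_comm]
          simp [Finset.sum_add_distrib, K]
      _ ≤ K * Real.log ((n : ℝ) ^ 3) + (∑ a : Fin (n + 1), (K * n + K * n)) / (n : ℝ) ^ 3 := by
          gcongr with a
          · exact hexp a s rfl
          · exact hexp a (-s) (by ring)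
      _ = K * (3 * s ^ 2 + 2 * (n + 1) / (n : ℝ) ^ 2) := by
          rw [Real.log_pow, hs2]
          simp
          field_simp
          ring
      _ ≤ K * (6 * s ^ 2) := by
          have : 2 * ((n : ℝ) + 1) / (n : ℝ) ^ 2 ≤ 3 / 2 := by
            rw [div_le_iff₀ (by positivity)]; nlinarith
          gcongr
          linarith
  have : s * ∑ x, ∑ a, p x a * |∑ k, settingSign x k * c a k| ≤ s * (K * (6 * s)) := by
    refine hmain.trans (le_of_eq (by ring))
  exact le_of_mul_le_mul_left this hs

lemma sum_settings_weight_mul_norm_le {n : ℕ} (hn : 2 ≤ n)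
    (p : Fin (2 ^ (n ^ 2)) → Fin (n + 1) → ℝ) (hp : ∀ x a, 0 ≤ p x a)
    (hp1 : ∀ x, ∑ a, p x a ≤ 1) (c : Fin (n + 1) → Fin n → ℂ) (hc : ∀ a, ∑ k, ‖c a k‖ ^ 2 ≤ 1) :
    ∑ x, ∑ a, p x a * ‖∑ k, (settingSign x k : ℂ) * c a k‖ ≤
      2 ^ (n ^ 2) * (12 * √(Real.log n)) := by
  have hre := sum_settings_weight_mul_abs_le hn p hp hp1 (fun a k => (c a k).re) fun a =>
    (Finset.sum_le_sum fun k _ => by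
      rw [← sq_abs]; gcongr; exact Complex.abs_re_le_norm _).trans (hc a)
  have him := sum_settings_weight_mul_abs_le hn p hp hp1 (fun a k => (c a k).im) fun a =>
    (Finset.sum_le_sum fun k _ => by
      rw [← sq_abs]; gcongr; exact Complex.abs_im_le_norm _).trans (hc a)
  calc _ ≤ ∑ x, ∑ a, (p x a * |∑ k, settingSign x k * (c a k).re| +
        p x a * |∑ k, settingSign x k * (c a k).im|) := by
        refine Finset.sum_le_sum fun x _ => Finset.sum_le_sum fun a _ => ?_
        rw [← mul_add]
        refine mul_le_mul_of_nonneg_left ((Complex.norm_le_abs_re_add_abs_im _).trans ?_) (hp x a)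
        simp
    _ ≤ _ := by
        simp only [Finset.sum_add_distrib]
        linarith

end Signs

/-! ### Characters of the cyclic group -/

section Fourier

/-- The characters `(a, i) ↦ exp(2πi ai/m)` of the cyclic group of order `m`. -/
noncomputable def fourierPhase (m : ℕ) (a i : Fin m) : ℂ :=
  (Complex.exp (2 * Real.pi * Complex.I / m) ^ (i : ℕ)) ^ (a : ℕ)

lemma norm_fourierPhase (m : ℕ) (a i : Fin m) : ‖fourierPhase m a i‖ = 1 := by
  have : ‖Complex.exp (2 * Real.pi * Complex.I / m)‖ = 1 := by
    rw [show 2 * (Real.pi : ℂ) * Complex.I / m = ((2 * Real.pi / m : ℝ) : ℂ) * Complex.I by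
      push_cast; ring]
    exact Complex.norm_exp_ofReal_mul_I _
  simp [fourierPhase, this]

lemma fourierPhase_zero (n : ℕ) (a : Fin (n + 1)) : fourierPhase (n + 1) a 0 = 1 := by
  simp [fourierPhase]

lemma sum_fourierPhase_mul_star (m : ℕ) (i j : Fin m) :
    ∑ a, fourierPhase m a i * star (fourierPhase m a j) = if i = j then (m : ℂ) else 0 := by
  split_ifs with hij
  · subst hij
    simp [Complex.mul_conj', norm_fourierPhase]
  · have hm : m ≠ 0 := fun h => by subst h; exact i.elim0
    have hζ := Complex.isPrimitiveRoot_exp m hm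
    have hn : ‖Complex.exp (2 * Real.pi * Complex.I / m)‖ = 1 := hζ.norm'_eq_one hm
    set ζ := Complex.exp (2 * Real.pi * Complex.I / m) with hζd
    set z := ζ ^ (i : ℕ) * star (ζ ^ (j : ℕ)) with hz
    have hzj : star (ζ ^ (j : ℕ)) * ζ ^ (j : ℕ) = 1 := by
      rw [Complex.star_def, Complex.conj_mul']; simp [hn]
    -- The sum is geometric with ratio `z = ζ^(i-j)`, an `m`-th root of unity other than 1.
    have hz1 : z ≠ 1 := fun h => hij <| Fin.ext <| hζ.pow_inj i.2 j.2 <| by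
      calc ζ ^ (i : ℕ) = z * ζ ^ (j : ℕ) := by rw [hz, mul_assoc, hzj, mul_one]
        _ = _ := by rw [h, one_mul]
    have hzm : z ^ m = 1 := by
      rw [hz, mul_pow, ← star_pow, ← pow_mul, ← pow_mul, mul_comm (i : ℕ), mul_comm (j : ℕ),
        pow_mul, pow_mul, hζ.pow_eq_one]
      simp
    have : ∀ a : Fin m, fourierPhase m a i * star (fourierPhase m a j) = z ^ (a : ℕ) := fun a => by
      simp only [fourierPhase, ← hζd, hz, mul_pow, star_pow]
    rw [Finset.sum_congr rfl fun a _ => this a, Fin.sum_univ_eq_sum_range (fun a => z ^ a),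
      geom_sum_eq hz1, hzm]
    simp

end Fourier

/-! ### Hermitian matrices supported on the first row and column -/

section BorderMatrix

/-- The Hermitian matrix `|v⟩⟨0| + |0⟩⟨v|`, where `v` is a vector orthogonal to `|0⟩`. -/
def borderMatrix {n : ℕ} (v : Fin n → ℂ) : Matrix (Fin (n + 1)) (Fin (n + 1)) ℂ :=
  Matrix.of fun i j =>
    Fin.cases (Fin.cases 0 (fun l => star (v l)) j) (fun k => Fin.cases (v k) (fun _ => 0) j) i

variable {n : ℕ} (v : Fin n → ℂ)

@[simp] lemma borderMatrix_zero_zero : borderMatrix v 0 0 = 0 := rfl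
@[simp] lemma borderMatrix_zero_succ (l : Fin n) : borderMatrix v 0 l.succ = star (v l) := rfl
@[simp] lemma borderMatrix_succ_zero (k : Fin n) : borderMatrix v k.succ 0 = v k := rfl
@[simp] lemma borderMatrix_succ_succ (k l : Fin n) : borderMatrix v k.succ l.succ = 0 := rfl

lemma isHermitian_borderMatrix : (borderMatrix v).IsHermitian := by
  ext i j
  rw [Matrix.conjTranspose_apply]
  refine Fin.cases ?_ (fun k => ?_) i <;> refine Fin.cases ?_ (fun l => ?_) j <;> simp

lemma sum_mul_borderMatrix (M : Matrix (Fin (n + 1)) (Fin (n + 1)) ℂ) :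
    ∑ i, ∑ j, M i j * borderMatrix v i j =
      ∑ k, (M 0 k.succ * star (v k) + M k.succ 0 * v k) := by
  simp [Fin.sum_univ_succ, Finset.sum_add_distrib, add_comm]

lemma trace_borderMatrix_mul (τ : Matrix (Fin (n + 1)) (Fin (n + 1)) ℂ) :
    (borderMatrix v * τ).trace = ∑ k, (τ k.succ 0 * star (v k) + τ 0 k.succ * v k) := by
  refine Eq.trans ?_ (sum_mul_borderMatrix v τ.transpose)
  simp only [Matrix.trace, Matrix.diag, Matrix.mul_apply, Matrix.transpose_apply, mul_comm]

lemma norm_trace_borderMatrix_mul_le {τ : Matrix (Fin (n + 1)) (Fin (n + 1)) ℂ}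
    (hτ : τ.IsHermitian) : ‖(borderMatrix v * τ).trace‖ ≤ 2 * ‖∑ k, v k * τ 0 k.succ‖ := by
  have h : (borderMatrix v * τ).trace = star (∑ k, v k * τ 0 k.succ) + ∑ k, v k * τ 0 k.succ := by
    rw [trace_borderMatrix_mul, Finset.sum_add_distrib, star_sum]
    congr 1
    · refine Finset.sum_congr rfl fun k _ => ?_
      rw [star_mul, hτ.apply]
    · exact Finset.sum_congr rfl fun k _ => mul_comm _ _
  rw [h, two_mul]
  exact (norm_add_le _ _).trans (by rw [norm_star])

lemma norm_borderMatrix_le (hv : ∀ k, ‖v k‖ ≤ 1) (i j : Fin (n + 1)) :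
    ‖borderMatrix v i j‖ ≤ (if (i : ℕ) = 0 then 1 else 0) + (if (j : ℕ) = 0 then 1 else 0) := by
  refine Fin.cases ?_ (fun k => ?_) i <;> refine Fin.cases ?_ (fun l => ?_) j <;> simp [hv]

end BorderMatrix

/-- The 2 × 2 minors bound the sum by `τ_00 (1 - τ_00)`. -/
lemma IsDensityMatrix.sum_norm_apply_sq_le {n : ℕ} {τ : Matrix (Fin (n + 1)) (Fin (n + 1)) ℂ}
    (hτ : IsDensityMatrix τ) : ∑ k : Fin n, ‖τ 0 k.succ‖ ^ 2 ≤ 1 := by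
  have htr : (τ 0 0).re + ∑ k : Fin n, (τ k.succ k.succ).re = 1 := by
    have := congrArg Complex.re hτ.2
    simpa [Matrix.trace, Fin.sum_univ_succ] using this
  have h0 := PosSemidef.re_diag_nonneg hτ.1 0
  have hs : 0 ≤ ∑ k : Fin n, (τ k.succ k.succ).re :=
    Finset.sum_nonneg fun k _ => PosSemidef.re_diag_nonneg hτ.1 _
  calc _ ≤ ∑ k : Fin n, (τ 0 0).re * (τ k.succ k.succ).re :=
        Finset.sum_le_sum fun k _ => PosSemidef.norm_apply_sq_le hτ.1 _ _
    _ = (τ 0 0).re * ∑ k : Fin n, (τ k.succ k.succ).re := by rw [Finset.mul_sum]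
    _ ≤ 1 := by nlinarith

/-! ### The functional: local and maximally entangled values -/

section Functional

variable {n : ℕ}

/-- The coordinates of the vector `v_x^a`, which are phases. -/
noncomputable def settingVector (x : Fin (2 ^ (n ^ 2))) (a : Fin (n + 1)) (k : Fin n) : ℂ :=
  settingSign x k * fourierPhase (n + 1) a k.succ

/-- The functional `F_x^a = 2^{-n²} (|v_x^a⟩⟨0| + |0⟩⟨v_x^a|)`. -/
noncomputable def phaseFunctional (n : ℕ) : Family (2 ^ (n ^ 2)) (n + 1) (n + 1) :=
  fun x a => ((2 ^ (n ^ 2) : ℝ)⁻¹ : ℝ) • borderMatrix (settingVector x a)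

lemma norm_settingVector (x : Fin (2 ^ (n ^ 2))) (a : Fin (n + 1)) (k : Fin n) :
    ‖settingVector x a k‖ = 1 := by
  have h : |settingSign x k| = 1 := by
    rcases mul_self_eq_one_iff.1 (settingSign_sq x k) with h | h <;> simp [h]
  simp [settingVector, norm_fourierPhase, h]

lemma isHermitian_phaseFunctional (x : Fin (2 ^ (n ^ 2))) (a : Fin (n + 1)) :
    (phaseFunctional n x a).IsHermitian :=
  (isHermitian_borderMatrix _).smul (IsSelfAdjoint.all _)

lemma norm_trace_phaseFunctional_mul_le (x : Fin (2 ^ (n ^ 2))) (a : Fin (n + 1))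
    {τ : Matrix (Fin (n + 1)) (Fin (n + 1)) ℂ} (hτ : τ.IsHermitian) :
    ‖(phaseFunctional n x a * τ).trace‖ ≤ (2 ^ (n ^ 2) : ℝ)⁻¹ *
      (2 * ‖∑ k, (settingSign x k : ℂ) * (fourierPhase (n + 1) a k.succ * τ 0 k.succ)‖) := by
  rw [phaseFunctional, Matrix.smul_mul, Matrix.trace_smul, norm_smul, Real.norm_of_nonneg
    (by positivity)]
  refine mul_le_mul_of_nonneg_left ((norm_trace_borderMatrix_mul_le _ hτ).trans (le_of_eq ?_))
    (by positivity)
  simp only [settingVector, mul_assoc]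

/-- By convexity a single hidden state suffices. The phases leave the ℓ² norm of its first row
unchanged, so the Rademacher estimate applies. -/
lemma norm_pairing_phaseFunctional_le_of_lhs (hn : 2 ≤ n)
    {σ : Family (2 ^ (n ^ 2)) (n + 1) (n + 1)} (hσ : σ ∈ lhsIncomplete _ _ _) :
    ‖pairing (phaseFunctional n) σ‖ ≤ 24 * √(Real.log n) := by
  obtain ⟨L, q, τ, p, hq, hq1, hτ, hp, hp1, hσ⟩ := hσ
  have hpair : pairing (phaseFunctional n) σ =
      ∑ l, (q l : ℂ) * ∑ x, ∑ a, (p l x a : ℂ) * (phaseFunctional n x a * τ l).trace := by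
    simp only [pairing, hσ, Matrix.trace_sum, Matrix.mul_smul, Matrix.trace_smul,
      Finset.mul_sum]
    rw [Finset.sum_congr rfl fun x _ => Finset.sum_comm, Finset.sum_comm]
    simp [mul_assoc]
  have hl : ∀ l, ‖∑ x, ∑ a, (p l x a : ℂ) * (phaseFunctional n x a * τ l).trace‖ ≤
      24 * √(Real.log n) := fun l => by
    have h := sum_settings_weight_mul_norm_le hn (p l) (hp l) (hp1 l)
      (fun a k => fourierPhase (n + 1) a k.succ * τ l 0 k.succ) fun a => by
        simpa [norm_fourierPhase] using IsDensityMatrix.sum_norm_apply_sq_le (hτ l)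
    calc _ ≤ ∑ x, ∑ a, ‖(p l x a : ℂ) * (phaseFunctional n x a * τ l).trace‖ :=
          (norm_sum_le _ _).trans (Finset.sum_le_sum fun _ _ => norm_sum_le _ _)
      _ ≤ ∑ x, ∑ a, (2 ^ (n ^ 2) : ℝ)⁻¹ * 2 * (p l x a *
            ‖∑ k, (settingSign x k : ℂ) * (fourierPhase (n + 1) a k.succ * τ l 0 k.succ)‖) := by
          refine Finset.sum_le_sum fun x _ => Finset.sum_le_sum fun a _ => ?_
          rw [norm_mul, Complex.norm_real, Real.norm_of_nonneg (hp l x a)]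
          exact (mul_le_mul_of_nonneg_left
            (norm_trace_phaseFunctional_mul_le x a (hτ l).1.isHermitian) (hp l x a)).trans
            (le_of_eq (by ring))
      _ ≤ (2 ^ (n ^ 2) : ℝ)⁻¹ * 2 * (2 ^ (n ^ 2) * (12 * √(Real.log n))) := by
          simp only [← Finset.mul_sum]
          exact mul_le_mul_of_nonneg_left h (by positivity)
      _ = _ := by field_simp; ring
  rw [hpair]
  calc _ ≤ ∑ l, q l * (24 * √(Real.log n)) := by
        refine (norm_sum_le _ _).trans (Finset.sum_le_sum fun l _ => ?_)
        rw [norm_mul, Complex.norm_real, Real.norm_of_nonneg (hq l)]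
        exact mul_le_mul_of_nonneg_left (hl l) (hq l)
    _ = _ := by rw [← Finset.sum_mul, hq1, one_mul]

lemma norm_pairing_phaseFunctional_le_of_maxEntangled {d : ℕ} (hd : 1 ≤ d) (hdn : d ≤ n + 1)
    {Θ : Family (2 ^ (n ^ 2)) (n + 1) (n + 1)} (hΘ : Θ ∈ maxEntangledAssemblages _ _ d _) :
    ‖pairing (phaseFunctional n) Θ‖ ≤ 2 := by
  obtain ⟨E, hE, rfl⟩ := hΘ
  have hd0 : (0 : ℝ) < d := by exact_mod_cast hd
  have hmax : maxEntangledState d (n + 1) = Matrix.vecMulVec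
      (diagVector (fun _ : Fin d => 1 / √(d : ℝ)) (n + 1))
      (star (diagVector (fun _ : Fin d => 1 / √(d : ℝ)) (n + 1))) := rfl
  have hsq : (1 / √(d : ℝ)) * (1 / √(d : ℝ)) = (d : ℝ)⁻¹ := by
    rw [div_mul_div_comm, Real.mul_self_sqrt hd0.le]; simp
  let i₀ : Fin d := ⟨0, hd⟩
  have hx : ∀ x, ∑ a, ‖(phaseFunctional n x a * steered E (maxEntangledState d (n + 1)) x a).trace‖
      ≤ (2 ^ (n ^ 2) : ℝ)⁻¹ * 2 := fun x => by
    have hterm : ∀ a, ‖(phaseFunctional n x a *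
        steered E (maxEntangledState d (n + 1)) x a).trace‖ ≤ (2 ^ (n ^ 2) : ℝ)⁻¹ * ((d : ℝ)⁻¹ *
          ∑ i, ((E x a i i).re + (E x a i₀ i₀).re)) := fun a => by
      rw [hmax, trace_mul_steered_diagVector hdn]
      have hi : ∀ i : Fin d, (i : ℕ) = 0 ↔ i = i₀ := fun i => by simp [i₀, Fin.ext_iff]
      -- Off-diagonal entries of `E` are bounded by the mean of two diagonal ones, which sum to 1
      -- over `a`; the indicators confine the sum to the first row and column.
      calc _ ≤ ∑ i, ∑ i', (2 ^ (n ^ 2) : ℝ)⁻¹ * ((d : ℝ)⁻¹ *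
            (((E x a i i).re + (E x a i' i').re) / 2 *
              ((if i = i₀ then 1 else 0) + (if i' = i₀ then 1 else 0)))) := by
            refine (norm_sum_le _ _).trans (Finset.sum_le_sum fun i _ =>
              (norm_sum_le _ _).trans (Finset.sum_le_sum fun i' _ => ?_))
            have hb := norm_borderMatrix_le (settingVector x a)
              (fun k => (norm_settingVector x a k).le) (Fin.castLE hdn i) (Fin.castLE hdn i')
            have he := PosSemidef.norm_apply_le ((hE x).1 a) i i'
            simp only [Fin.val_castLE, hi] at hb
            rw [← Complex.ofReal_mul, hsq, phaseFunctional, Matrix.smul_apply, norm_mul, norm_mul,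
              norm_smul, Complex.norm_real, Real.norm_of_nonneg (by positivity),
              Real.norm_of_nonneg (by positivity)]
            calc _ = (2 ^ (n ^ 2) : ℝ)⁻¹ * ((d : ℝ)⁻¹ * (‖E x a i i'‖ *
                  ‖borderMatrix (settingVector x a) (Fin.castLE hdn i) (Fin.castLE hdn i')‖)) := by
                  ring
              _ ≤ _ := by
                have := (norm_nonneg _).trans he
                gcongr
        _ = _ := by
            simp only [← Finset.mul_sum, mul_add, Finset.sum_add_distrib]
            simp [← Finset.sum_div, Finset.sum_add_distrib]
            field_simp
            ring
    refine (Finset.sum_le_sum fun a _ => hterm a).trans (le_of_eq ?_)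
    have hdiag : ∀ i, ∑ a, (E x a i i).re = 1 := fun i => by
      have := congrArg (fun M => (M i i).re) (hE x).2
      simpa [Matrix.sum_apply] using this
    rw [← Finset.mul_sum, ← Finset.mul_sum, Finset.sum_comm]
    simp only [Finset.sum_add_distrib, hdiag]
    simp
    field_simp
    ring
  calc _ ≤ ∑ x : Fin (2 ^ (n ^ 2)), (2 ^ (n ^ 2) : ℝ)⁻¹ * 2 :=
        (norm_pairing_le _ _).trans (Finset.sum_le_sum fun x _ => hx x)
    _ = 2 := by simp

/-! ### The measurement and the state of large quantum value -/

/-- The phases `v_x^a` preceded by the coordinate `1`. -/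
noncomputable def extendedVector (x : Fin (2 ^ (n ^ 2))) (a : Fin (n + 1)) : Fin (n + 1) → ℂ :=
  fun i => ((Fin.cons 1 (settingSign x) : Fin (n + 1) → ℝ) i : ℂ) * fourierPhase (n + 1) a i

@[simp] lemma extendedVector_zero (x : Fin (2 ^ (n ^ 2))) (a : Fin (n + 1)) :
    extendedVector x a 0 = 1 := by
  simp [extendedVector, fourierPhase_zero]

@[simp] lemma extendedVector_succ (x : Fin (2 ^ (n ^ 2))) (a : Fin (n + 1)) (k : Fin n) :
    extendedVector x a k.succ = settingVector x a k := by
  simp [extendedVector, settingVector]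

lemma settingVector_mul_star (x : Fin (2 ^ (n ^ 2))) (a : Fin (n + 1)) (k : Fin n) :
    settingVector x a k * star (settingVector x a k) = 1 := by
  rw [Complex.star_def, Complex.mul_conj', norm_settingVector]; simp

/-- The projection onto the line spanned by the phase vector. -/
noncomputable def phaseProjection (x : Fin (2 ^ (n ^ 2))) (a : Fin (n + 1)) :
    Matrix (Fin (n + 1)) (Fin (n + 1)) ℂ :=
  ((n + 1 : ℝ)⁻¹ : ℝ) • Matrix.vecMulVec (extendedVector x a) (star (extendedVector x a))

lemma posSemidef_phaseProjection (x : Fin (2 ^ (n ^ 2))) (a : Fin (n + 1)) :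
    (phaseProjection x a).PosSemidef :=
  (Matrix.posSemidef_vecMulVec_self_star _).smul (by positivity)

/-- Character orthogonality kills the off-diagonal entries, and the signs square to 1 on the
diagonal. -/
lemma sum_phaseProjection (x : Fin (2 ^ (n ^ 2))) : ∑ a, phaseProjection x a = 1 := by
  ext i j
  have hn : (n : ℂ) + 1 ≠ 0 := by exact_mod_cast n.succ_ne_zero
  have hs : (Fin.cons 1 (settingSign x) : Fin (n + 1) → ℝ) i *
      (Fin.cons 1 (settingSign x) : Fin (n + 1) → ℝ) i = 1 := by
    refine Fin.cases ?_ (fun k => ?_) i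
    · simp
    · simpa using settingSign_sq x k
  calc _ = ((n : ℂ) + 1)⁻¹ * (((Fin.cons 1 (settingSign x) : Fin (n + 1) → ℝ) i : ℂ) *
        ((Fin.cons 1 (settingSign x) : Fin (n + 1) → ℝ) j : ℂ) *
        ∑ a, fourierPhase (n + 1) a i * star (fourierPhase (n + 1) a j)) := by
        rw [Matrix.sum_apply, Finset.mul_sum, Finset.mul_sum]
        refine Finset.sum_congr rfl fun a _ => ?_
        simp only [phaseProjection, Matrix.smul_apply, Matrix.vecMulVec_apply, Pi.star_apply,
          extendedVector, star_mul, Complex.star_def, Complex.conj_ofReal, Complex.real_smul]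
        push_cast
        ring
    _ = _ := by
        rw [sum_fourierPhase_mul_star, Matrix.one_apply]
        split_ifs with h
        · subst h
          rw [← Complex.ofReal_mul, hs]
          push_cast
          field_simp
        · simp

lemma isDensityMatrix_phaseProjection (x : Fin (2 ^ (n ^ 2))) (a : Fin (n + 1)) :
    IsDensityMatrix (phaseProjection x a) := by
  refine ⟨posSemidef_phaseProjection x a, ?_⟩
  have hn : (n : ℂ) + 1 ≠ 0 := by exact_mod_cast n.succ_ne_zero
  simp only [phaseProjection, Matrix.trace_smul, Matrix.trace_vecMulVec, dotProduct,
    Fin.sum_univ_succ, Pi.star_apply, extendedVector_zero, extendedVector_succ,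
    settingVector_mul_star, star_one, Finset.sum_const, Finset.card_univ, Fintype.card_fin,
    nsmul_eq_mul, Complex.real_smul, mul_one]
  push_cast
  field_simp
  ring

lemma trace_phaseFunctional_mul_phaseProjection (x : Fin (2 ^ (n ^ 2))) (a : Fin (n + 1)) :
    (phaseFunctional n x a * phaseProjection x a).trace =
      ((2 ^ (n ^ 2) : ℝ)⁻¹ * ((n + 1 : ℝ)⁻¹ * (2 * n)) : ℝ) := by
  rw [phaseFunctional, Matrix.smul_mul, Matrix.trace_smul, trace_borderMatrix_mul]
  have h : ∀ k, phaseProjection x a k.succ 0 * star (settingVector x a k) +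
      phaseProjection x a 0 k.succ * settingVector x a k = ((n + 1 : ℝ)⁻¹ * 2 : ℝ) := fun k => by
    simp only [phaseProjection, Matrix.smul_apply, Matrix.vecMulVec_apply, Pi.star_apply,
      extendedVector_zero, extendedVector_succ, Complex.real_smul, star_one]
    push_cast
    linear_combination (2 * ((n : ℂ) + 1)⁻¹) * settingVector_mul_star x a k
  simp only [h, Finset.sum_const, Finset.card_univ, Fintype.card_fin, nsmul_eq_mul,
    Complex.real_smul]
  push_cast
  ring

/-- Needed for `lhsBound` to be positive. Incompleteness allows a strategy that answers one setting
with one outcome and is silent elsewhere, so a single nonzero term remains. -/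
lemma exists_lhs_pairing_phaseFunctional_ne_zero (hn : 2 ≤ n) :
    ∃ σ ∈ lhsIncomplete (2 ^ (n ^ 2)) (n + 1) (n + 1), pairing (phaseFunctional n) σ ≠ 0 := by
  let x₀ : Fin (2 ^ (n ^ 2)) := ⟨0, by positivity⟩
  refine ⟨fun x a => ∑ _l : Fin 1, ((1 * (if x = x₀ ∧ a = 0 then 1 else 0) : ℝ) : ℂ) •
    phaseProjection x₀ 0, ⟨1, fun _ => 1, fun _ => phaseProjection x₀ 0,
    fun _ x a => if x = x₀ ∧ a = 0 then 1 else 0, by simp, by simp,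
    fun _ => isDensityMatrix_phaseProjection _ _, fun _ x a => by positivity, fun _ x => ?_,
    fun _ _ => rfl⟩, ?_⟩
  · by_cases h : x = x₀ <;> simp [h]
  · have : pairing (phaseFunctional n) (fun x a => ∑ _l : Fin 1,
        ((1 * (if x = x₀ ∧ a = 0 then 1 else 0) : ℝ) : ℂ) • phaseProjection x₀ 0) =
        (phaseFunctional n x₀ 0 * phaseProjection x₀ 0).trace := by
      rw [pairing, Finset.sum_eq_single x₀, Finset.sum_eq_single 0] <;> simp +contextual
    rw [this, trace_phaseFunctional_mul_phaseProjection, Complex.ofReal_ne_zero]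
    positivity

lemma sqrt_le_quantumBound_phaseFunctional (hn : 2 ≤ n) :
    √(n : ℝ) ≤ quantumBound (phaseFunctional n) := by
  have hn0 : (0 : ℝ) < n := by exact_mod_cast (by omega : 0 < n)
  let t : Fin (n + 1) → ℝ := Fin.cons (1 / √2) fun _ => 1 / √(2 * n)
  let E : Fin (2 ^ (n ^ 2)) → Fin (n + 1) → Matrix (Fin (n + 1)) (Fin (n + 1)) ℂ :=
    -- The transpose turns the entrywise pairing of `E` with the functional into a trace against the
    -- phase projection.
    fun x a => (phaseProjection x a).transpose
  let ρ := Matrix.vecMulVec (diagVector t (n + 1)) (star (diagVector t (n + 1)))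
  have ht : t 0 * t 0 + n * ((1 / √(2 * n : ℝ)) * (1 / √(2 * n : ℝ))) = 1 := by
    have h1 := Real.mul_self_sqrt (show (0 : ℝ) ≤ 2 by norm_num)
    have h2 := Real.mul_self_sqrt (show (0 : ℝ) ≤ 2 * n by positivity)
    simp only [t, Fin.cons_zero, div_mul_div_comm, h1, h2]
    field_simp
    norm_num
  have htt : t 0 * (1 / √(2 * n : ℝ)) = √n / (2 * n) := by
    simp only [t, Fin.cons_zero]
    rw [div_mul_div_comm, ← Real.sqrt_mul (by norm_num), ← mul_assoc,
      Real.sqrt_mul (by norm_num), Real.sqrt_mul_self (by norm_num)]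
    have := Real.mul_self_sqrt hn0.le
    have hs : √(n : ℝ) ≠ 0 := (Real.sqrt_pos.2 hn0).ne'
    field_simp
    nlinarith
  have hρ : IsDensityMatrix ρ := by
    refine ⟨Matrix.posSemidef_vecMulVec_self_star _, ?_⟩
    have hst : ∀ p, star (diagVector t (n + 1) p) = diagVector t (n + 1) p := fun p => by
      unfold diagVector; split_ifs <;> simp
    simp only [ρ, Matrix.trace, Matrix.diag, Matrix.vecMulVec_apply, Fintype.sum_prod_type,
      Pi.star_apply, hst, sum_diagVector_mul le_rfl]
    simp only [diagVector, Fin.val_castLE, if_true, Fin.sum_univ_succ]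
    have := congrArg (fun r : ℝ => (r : ℂ)) ht
    simpa [t] using this
  have hE : ∀ x, IsIncompletePOVM (E x) := fun x => by
    refine ⟨fun a => (posSemidef_phaseProjection x a).transpose, ?_⟩
    have : ∑ a, E x a = 1 := by
      rw [← Matrix.transpose_sum, sum_phaseProjection, Matrix.transpose_one]
    rw [this, sub_self]
    exact Matrix.PosSemidef.zero
  have hterm : ∀ x a, (phaseFunctional n x a * steered E ρ x a).trace =
      ((2 ^ (n ^ 2) : ℝ)⁻¹ * ((n + 1 : ℝ)⁻¹ * √n) : ℝ) := fun x a => by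
    rw [trace_mul_steered_diagVector le_rfl]
    have h : ∀ i i', (t i : ℂ) * t i' * E x a i i' * phaseFunctional n x a
        (Fin.castLE le_rfl i) (Fin.castLE le_rfl i') = ((2 ^ (n ^ 2) : ℝ)⁻¹ : ℝ) *
        ((Matrix.of fun i i' => (t i : ℂ) * t i' * E x a i i') i i' *
          borderMatrix (settingVector x a) i i') := fun i i' => by
      simp only [phaseFunctional, Matrix.smul_apply, Complex.real_smul, Matrix.of_apply,
        Fin.castLE_rfl, id]
      ring
    simp only [h, ← Finset.mul_sum]
    rw [sum_mul_borderMatrix, Complex.ofReal_mul]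
    congr 1
    have hk : ∀ k : Fin n, (Matrix.of fun i i' => (t i : ℂ) * t i' * E x a i i') 0 k.succ *
        star (settingVector x a k) + (Matrix.of fun i i' => (t i : ℂ) * t i' * E x a i i') k.succ 0
        * settingVector x a k = (((n + 1 : ℝ)⁻¹ * (2 * (√n / (2 * n))) : ℝ) : ℂ) := fun k => by
      rw [← htt]
      have h1 := settingVector_mul_star x a k
      simp only [Matrix.of_apply, E, Matrix.transpose_apply, phaseProjection, Matrix.smul_apply,
        Matrix.vecMulVec_apply, Pi.star_apply, extendedVector_zero, extendedVector_succ,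
        Complex.real_smul, star_one, t, Fin.cons_zero, Fin.cons_succ]
      push_cast
      linear_combination (2 * ((n : ℂ) + 1)⁻¹ * (1 / (√2 : ℝ)) * (1 / (√(2 * n) : ℝ))) * h1
    simp only [hk]
    rw [Finset.sum_const, Finset.card_univ, Fintype.card_fin, nsmul_eq_mul, ← Complex.ofReal_natCast,
      ← Complex.ofReal_mul]
    congr 1
    field_simp
  have hpair : pairing (phaseFunctional n) (steered E ρ) = (√n : ℝ) := by
    simp only [pairing, hterm, Finset.sum_const, Finset.card_univ, Fintype.card_fin, nsmul_eq_mul]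
    have hn1 : (n : ℂ) + 1 ≠ 0 := by exact_mod_cast n.succ_ne_zero
    push_cast
    field_simp
  refine le_csSup (bddAbove_norm_pairing_quantumIncomplete _)
    ⟨steered E ρ, ⟨n + 1, ρ, E, hρ, hE, rfl⟩, ?_⟩
  simp only [hpair, Complex.norm_real, Real.norm_of_nonneg (Real.sqrt_nonneg _)]

end Functional

end Steering

theorem mainTheorem4 :
    ∃ c C : ℝ, 0 < c ∧ 0 < C ∧ ∀ n : ℕ, 2 ≤ n →
      ∃ F : Steering.Family (2 ^ (n ^ 2)) (n + 1) (n + 1),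
        (∀ x a, (F x a).IsHermitian) ∧
        0 < Steering.lhsBound F ∧
        Steering.lhsBound F ≤ C * √(Real.log n) ∧
        c * √(n : ℝ) ≤ Steering.quantumBound F ∧
        c * (√(n : ℝ) / √(Real.log n)) ≤ Steering.largestViolation F ∧
        ∀ d : ℕ, 1 ≤ d → d ≤ n + 1 →
          ∀ Θ ∈ Steering.maxEntangledAssemblages (2 ^ (n ^ 2)) (n + 1) d (n + 1),
            ‖Steering.pairing F Θ‖ ≤ C * √(Real.log n) := by
  -- 24 is 6 from the real Rademacher estimate, doubled for real and imaginary parts and again for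
  -- the two borders. It also absorbs the constant 2, as `√(log n) ≥ 1/2`.
  refine ⟨1 / 24, 24, by norm_num, by norm_num, fun n hn => ⟨Steering.phaseFunctional n,
    Steering.isHermitian_phaseFunctional, ?_⟩⟩
  have hn' : (2 : ℝ) ≤ n := by exact_mod_cast hn
  have hlog : 1 / 4 ≤ Real.log n :=
    (by linarith [Real.log_two_gt_d9] : (1 / 4 : ℝ) ≤ Real.log 2).trans
      (Real.log_le_log (by norm_num) hn')
  have hs : 1 / 2 ≤ √(Real.log n) := Real.le_sqrt_of_sq_le (by linarith)
  have hub : ∀ y ∈ (fun σ => ‖Steering.pairing (Steering.phaseFunctional n) σ‖) ''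
      Steering.lhsIncomplete (2 ^ (n ^ 2)) (n + 1) (n + 1), y ≤ 24 * √(Real.log n) := by
    rintro _ ⟨σ, hσ, rfl⟩
    exact Steering.norm_pairing_phaseFunctional_le_of_lhs hn hσ
  obtain ⟨σ, hσ, hσ0⟩ := Steering.exists_lhs_pairing_phaseFunctional_ne_zero hn
  have hpos : 0 < Steering.lhsBound (Steering.phaseFunctional n) :=
    (norm_pos_iff.2 hσ0).trans_le (le_csSup ⟨_, hub⟩ ⟨σ, hσ, rfl⟩)
  have hle : Steering.lhsBound (Steering.phaseFunctional n) ≤ 24 * √(Real.log n) :=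
    csSup_le ⟨_, σ, hσ, rfl⟩ hub
  have hq := Steering.sqrt_le_quantumBound_phaseFunctional hn
  refine ⟨hpos, hle, ?_, ?_, fun d hd hdn Θ hΘ => ?_⟩
  · linarith [Real.sqrt_nonneg (n : ℝ)]
  · calc 1 / 24 * (√(n : ℝ) / √(Real.log n)) = √n / (24 * √(Real.log n)) := by
          field_simp
      _ ≤ _ := by
          unfold Steering.largestViolation
          gcongr
          exact (Real.sqrt_nonneg _).trans hq
  · exact (Steering.norm_pairing_phaseFunctional_le_of_maxEntangled hd hdn hΘ).trans (by linarith)
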